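/- Consider the Ising channel with ternary alphabet $\mathcal X=\mathcal S=\mathcal Y=\{0,1,2\}$: if the channel is in state $s$ and the input is $x$, the output is $y=x$ with probability $1/2$ and $y=s$ with probability $1/2$ (so $y=x$ surely if $x=s$), independently of the past given $(x,s)$, and the new state is $s'=x$. The channel starts in a state $s_0$ known to encoder and decoder. A feedback code of block length $n$ with $M$ messages consists of encoding functions giving the input $x_t$ from the message and the past outputs $y_1,\dots,y_{t-1}$, for $1\le t\le n$, and a decoding function giving an estimate of the message from $y_1,\dots,y_n$ (all of these may depend on $s_0$). A rate $R$ is achievable if there are feedback codes of block length $n$ with $\lceil 2^{nR}\rceil$ messages, $n=0,1,2,\dots$, whose average error probability for a uniformly distributed message tends to $0$ as $n\to\infty$. The feedback capacity $C_{\mathrm{fb}}$ is the supremum of the achievable rates. Theorem. For every initial state $s_0$, the feedback capacity of the ternary Ising channel is $$C_{\mathrm{fb}}=\max_{p\in[0,1]}\frac{2\,\bigl(H_2(p)+1-p\bigr)}{p+3},$$ where $H_2(p)=-p\log_2 p-(1-p)\log_2(1-p)$ (with $0\log_2 0=0$). Moreover $|C_{\mathrm{fb}}-0.961227|\le 5\cdot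 10^{-7}$, and the maximum is attained at some $p$ with $|p-0.263805|\le 5\cdot 10^{-7}$. -/

import Mathlib

open Filter Topology

noncomputable section

/-- A unifilar finite-state channel with input alphabet `X`, state alphabet `S` and output
alphabet `Y`: `prob x s y` is `p(y | x, s)` and `next x y s` is the new state `f(x, y, s)`. -/
structure UnifilarFSC (X S Y : Type*) [Fintype Y] where
  prob : X → S → Y → ℝ
  prob_nonneg : ∀ x s y, 0 ≤ prob x s y
  prob_sum : ∀ x s, ∑ y, prob x s y = 1
  next : X → Y → S → S

namespace UnifilarFSC

variable {X S Y : Type*} [Fintype Y]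

/-- A feedback strategy: the input at time `t` (counted from `0`) as a function of the
previous outputs `y 0, …, y (t - 1)`. -/
abbrev Strategy (X Y : Type*) : Type _ := (t : ℕ) → (Fin t → Y) → X

/-- The channel state after `t` uses, when it starts in `s₀`, the inputs follow the strategy `f`,
and the outputs were `y`. -/
def stateAfter (ch : UnifilarFSC X S Y) (s₀ : S) (f : Strategy X Y) :
    (t : ℕ) → (Fin t → Y) → S
  | 0, _ => s₀
  | t + 1, y =>
      ch.next (f t (Fin.init y)) (y (Fin.last t)) (ch.stateAfter s₀ f t (Fin.init y))

/-- The probability that the first `t` outputs are `y`, when the channel starts in `s₀` and the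
inputs follow the strategy `f`. -/
def outputProb (ch : UnifilarFSC X S Y) (s₀ : S) (f : Strategy X Y) :
    (t : ℕ) → (Fin t → Y) → ℝ
  | 0, _ => 1
  | t + 1, y =>
      ch.outputProb s₀ f t (Fin.init y) *
        ch.prob (f t (Fin.init y)) (ch.stateAfter s₀ f t (Fin.init y)) (y (Fin.last t))

/-- A feedback code with `M` messages and block length `n`. Only the inputs at the times `t < n`
matter. The code may be chosen depending on the initial state, so the latter is known to
both the encoder and the decoder. -/
structure FeedbackCode (X Y : Type*) (M n : ℕ) where
  enc : Fin M → Strategy X Y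
  dec : (Fin n → Y) → Fin M

/-- The average probability of error, for a uniformly distributed message. -/
def errorProb (ch : UnifilarFSC X S Y) (s₀ : S) {M n : ℕ} (c : FeedbackCode X Y M n) : ℝ :=
  (∑ m : Fin M, ∑ y : Fin n → Y,
    if c.dec y = m then 0 else ch.outputProb s₀ (c.enc m) n y) / M

/-- The rate `R` (in bits per channel use) is achievable with feedback from the initial state `s₀`:
some codes with `⌈2 ^ (n R)⌉` messages and block length `n` have error probability tending to `0`. -/
def IsAchievable (ch : UnifilarFSC X S Y) (s₀ : S) (R : ℝ) : Prop :=
  ∃ c : (n : ℕ) → FeedbackCode X Y ⌈(2 : ℝ) ^ ((n : ℝ) * R)⌉₊ n,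
    Tendsto (fun n => ch.errorProb s₀ (c n)) atTop (𝓝 0)

/-- `C` is the feedback capacity from the initial state `s₀`: the supremum of the
achievable rates. -/
def IsFeedbackCapacity (ch : UnifilarFSC X S Y) (s₀ : S) (C : ℝ) : Prop :=
  IsLUB {R : ℝ | ch.IsAchievable s₀ R} C

/-- The Ising channel over the alphabet `A`: the output is the input `x` or the state `s`, with
probability `1 / 2` each, and the new state is the input. -/
def ising (A : Type*) [Fintype A] [DecidableEq A] : UnifilarFSC A A A where
  prob x s y := (1 / 2) * (if y = x then 1 else 0) + (1 / 2) * (if y = s then 1 else 0)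
  prob_nonneg x s y := by positivity
  prob_sum x s := by
    rw [Finset.sum_add_distrib, ← Finset.mul_sum, ← Finset.mul_sum]
    simp
    norm_num
  next x _ _ := x

end UnifilarFSC

/-- The binary entropy function in bits. -/
def binEntropyBits (p : ℝ) : ℝ := Real.binEntropy p / Real.log 2

/-- The function `2 (H₂(p) + 1 - p) / (p + 3)`. -/
def ising3Rate (p : ℝ) : ℝ := 2 * ((binEntropyBits p + 1 - p) / (p + 3))

end

/-! Let `p` be the root of `16 p³ = (1 - p)⁴`, the stationarity condition of `ising3Rate`. It makes
`log (1 - p)` linear in `log p`, and every quantity below collapses to the constant `c = -log p / 2`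
nats per channel use.

Scheme: from a state `r` known to the decoder, the encoder sends `r + d`. An output other than `r`
reveals the input, which is the new known state. An output `r` is ambiguous, but then the same input
is sent again; it now equals the state, so the output is certain. Thus `d = 0` costs two uses and `d
≠ 0` one or two with probability 1/2 each. Words of length `k` with `j` zeros take `(3k + j) / 2`
uses on average, there are `k.choose j * 2 ^ (k - j)` of them, and `j ≈ pk` gives the rate
`ising3Rate p`. A Chernoff bound controls the decoding time (`sum_outputProb_short_le`,
`exists_ising_code`).

Converse: outputs of any strategy are compared with one test law, the output law of the scheme with
independent increments that are 0 with probability `p` and otherwise uniform. The relative value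
function `value` satisfies a Bellman inequality with gain `c` for every node, state and input
(`bellman`), so the divergence is at most `n * c` plus a constant (`divergence_le`). A Fano-type
bound (`one_sub_errorProb_mul_log_le`) turns this into a bound on the rate. -/

namespace UnifilarFSC

/-! ### Output processes and a Fano-type bound for general channels -/

section General

variable {X S Y : Type*} [Fintype Y]

theorem sum_fin_succ_eq_sum_snoc {t : ℕ} (F : (Fin (t + 1) → Y) → ℝ) :
    ∑ y, F y = ∑ y : Fin t → Y, ∑ a : Y, F (Fin.snoc (α := fun _ => Y) y a) := by
  rw [← (Fin.snocEquiv (fun _ : Fin (t + 1) => Y)).sum_comp, Fintype.sum_prod_type,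
    Finset.sum_comm]
  rfl

theorem outputProb_nonneg (ch : UnifilarFSC X S Y) (s₀ : S) (f : Strategy X Y) :
    ∀ (t : ℕ) (y : Fin t → Y), 0 ≤ ch.outputProb s₀ f t y
  | 0, _ => zero_le_one
  | t + 1, _ => mul_nonneg (outputProb_nonneg ch s₀ f t _) (ch.prob_nonneg _ _ _)

theorem outputProb_snoc (ch : UnifilarFSC X S Y) (s₀ : S) (f : Strategy X Y) {t : ℕ}
    (y : Fin t → Y) (a : Y) :
    ch.outputProb s₀ f (t + 1) (Fin.snoc (α := fun _ => Y) y a) =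
      ch.outputProb s₀ f t y * ch.prob (f t y) (ch.stateAfter s₀ f t y) a := by
  simp [outputProb]

theorem stateAfter_snoc (ch : UnifilarFSC X S Y) (s₀ : S) (f : Strategy X Y) {t : ℕ}
    (y : Fin t → Y) (a : Y) :
    ch.stateAfter s₀ f (t + 1) (Fin.snoc (α := fun _ => Y) y a) =
      ch.next (f t y) a (ch.stateAfter s₀ f t y) := by
  simp [stateAfter]

/-- The expectation of a supermartingale of the output process is at most its initial value. -/
theorem sum_outputProb_mul_le (ch : UnifilarFSC X S Y) (s₀ : S) (f : Strategy X Y)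
    (F : (t : ℕ) → (Fin t → Y) → ℝ)
    (hF : ∀ t y, ch.outputProb s₀ f t y ≠ 0 →
      ∑ a, ch.prob (f t y) (ch.stateAfter s₀ f t y) a *
        F (t + 1) (Fin.snoc (α := fun _ => Y) y a) ≤ F t y) (n : ℕ) :
    ∑ y, ch.outputProb s₀ f n y * F n y ≤ F 0 Fin.elim0 := by
  induction n with
  | zero => simp [outputProb, Subsingleton.elim (default : Fin 0 → Y) Fin.elim0]
  | succ n ih =>
    refine le_trans ?_ ih
    rw [sum_fin_succ_eq_sum_snoc]
    refine Finset.sum_le_sum fun y _ => ?_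
    simp only [outputProb_snoc, mul_assoc]
    rw [← Finset.mul_sum]
    by_cases h : ch.outputProb s₀ f n y = 0
    · simp [h]
    · exact mul_le_mul_of_nonneg_left (hF n y h) (outputProb_nonneg ch s₀ f n y)

theorem sum_outputProb (ch : UnifilarFSC X S Y) (s₀ : S) (f : Strategy X Y) (n : ℕ) :
    ∑ y, ch.outputProb s₀ f n y = 1 := by
  induction n with
  | zero => simp [outputProb]
  | succ n ih =>
    rw [sum_fin_succ_eq_sum_snoc, ← ih]
    refine Finset.sum_congr rfl fun y _ => ?_
    simp only [outputProb_snoc]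
    rw [← Finset.mul_sum, ch.prob_sum, mul_one]

theorem errorProb_nonneg (ch : UnifilarFSC X S Y) (s₀ : S) {M n : ℕ} (c : FeedbackCode X Y M n) :
    0 ≤ ch.errorProb s₀ c := by
  refine div_nonneg (Finset.sum_nonneg fun m _ => Finset.sum_nonneg fun y _ => ?_) M.cast_nonneg
  split_ifs
  · exact le_rfl
  · exact outputProb_nonneg ch s₀ _ n y

/-- This is `log t ≥ 1 - 1 / t` at `t = x / (c * y)`, multiplied by `x`; the factor `c` weights
correct and wrong decoding differently below. -/
theorem mul_log_div_ge {x y c : ℝ} (hx : 0 ≤ x) (hy : 0 < y) (hc : 0 < c) :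
    x * Real.log c + x - c * y ≤ x * (Real.log x - Real.log y) := by
  rcases hx.eq_or_lt with rfl | hx
  · simp; positivity
  · have h := Real.one_sub_inv_le_log_of_pos (show 0 < x / (c * y) by positivity)
    rw [Real.log_div hx.ne' (by positivity), Real.log_mul hc.ne' hy.ne'] at h
    have h2 := mul_le_mul_of_nonneg_left h hx.le
    have h3 : x * (1 - (x / (c * y))⁻¹) = x - c * y := by field_simp
    rw [h3] at h2
    linarith

/-- If the output distributions of all strategies are within divergence `K` of one test
distribution `Q`, then the number of messages of a code is bounded by `K`. -/
theorem one_sub_errorProb_mul_log_le (ch : UnifilarFSC X S Y) (s₀ : S) {M n : ℕ} (hM : 0 < M)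
    (c : FeedbackCode X Y M n) (Q : (Fin n → Y) → ℝ) (hQ : ∀ y, 0 < Q y) (hQ1 : ∑ y, Q y = 1)
    (K : ℝ) (hK : ∀ f : Strategy X Y, ∑ y, ch.outputProb s₀ f n y *
      (Real.log (ch.outputProb s₀ f n y) - Real.log (Q y)) ≤ K) :
    (1 - ch.errorProb s₀ c) * Real.log M ≤ K + 1 := by
  have hM' : (0 : ℝ) < M := by exact_mod_cast hM
  have key : ∀ m, Real.log M - (∑ y, if c.dec y = m then 0 else
      ch.outputProb s₀ (c.enc m) n y) * Real.log M
      - M * (∑ y, if c.dec y = m then Q y else 0) ≤ K := by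
    intro m
    refine le_trans ?_ (hK (c.enc m))
    have h1 : Real.log M = ∑ y, ch.outputProb s₀ (c.enc m) n y * Real.log M := by
      rw [← Finset.sum_mul, sum_outputProb, one_mul]
    have h2 : ∑ y, (ch.outputProb s₀ (c.enc m) n y - Q y) = 0 := by
      rw [Finset.sum_sub_distrib, sum_outputProb, hQ1, sub_self]
    have h3 : Real.log M - (∑ y, if c.dec y = m then 0 else
        ch.outputProb s₀ (c.enc m) n y) * Real.log M
        - M * (∑ y, if c.dec y = m then Q y else 0) =
        ∑ y, (ch.outputProb s₀ (c.enc m) n y * Real.log M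
          - (if c.dec y = m then 0 else ch.outputProb s₀ (c.enc m) n y) * Real.log M
          - M * (if c.dec y = m then Q y else 0) + (ch.outputProb s₀ (c.enc m) n y - Q y)) := by
      rw [Finset.sum_add_distrib, h2, Finset.sum_sub_distrib, Finset.sum_sub_distrib, ← h1,
        Finset.sum_mul, Finset.mul_sum, add_zero]
    rw [h3]
    refine Finset.sum_le_sum fun y _ => ?_
    have hP := outputProb_nonneg ch s₀ (c.enc m) n y
    -- The pointwise bound is taken with factor `M` where `m` is decoded and with factor 1
    -- elsewhere. Averaged over `m`, the `Q` terms of the decoding regions add up to 1.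
    by_cases h : c.dec y = m
    · have := mul_log_div_ge hP (hQ y) hM'
      simp only [h, if_true]
      linarith [hQ y]
    · have := mul_log_div_ge hP (hQ y) one_pos
      simp only [h, if_false]
      simp only [Real.log_one] at this
      linarith
  have hsum := Finset.sum_le_sum fun m (_ : m ∈ Finset.univ) => key m
  rw [Finset.sum_sub_distrib, Finset.sum_sub_distrib, ← Finset.sum_mul, ← Finset.mul_sum,
    Finset.sum_comm (f := fun m y => if c.dec y = m then Q y else 0)] at hsum
  simp only [Finset.sum_ite_eq, Finset.mem_univ, if_true, hQ1, Finset.sum_const,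
    Finset.card_univ, Fintype.card_fin, nsmul_eq_mul] at hsum
  set E := ∑ m : Fin M, ∑ y, if c.dec y = m then 0 else ch.outputProb s₀ (c.enc m) n y with hE
  have hdef : ch.errorProb s₀ c = E / M := rfl
  have hE' : E = M * ch.errorProb s₀ c := by rw [hdef]; field_simp
  rw [hE'] at hsum
  refine le_of_mul_le_mul_left ?_ hM'
  linarith

end General

end UnifilarFSC

/-! ### Decoder nodes and the Bellman inequality -/

namespace UnifilarFSC

/-- The decoder's knowledge of the state of the Ising channel. In `(r, false)` the state is
believed to be `r`; in `(r, true)` the state was `r` one step ago and the output was `r`. -/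
abbrev IsingNode : Type := Fin 3 × Bool

namespace IsingNode

/-- The update of the decoder's knowledge by the output `y`. -/
def step (v : IsingNode) (y : Fin 3) : IsingNode :=
  if y = v.1 ∧ v.2 = false then (v.1, true) else (y, false)

/-- The node reached from `(s₀, false)` by the outputs `y`. -/
def after (s₀ : Fin 3) : (t : ℕ) → (Fin t → Fin 3) → IsingNode
  | 0, _ => (s₀, false)
  | t + 1, y => (after s₀ t (Fin.init y)).step (y (Fin.last t))

theorem after_snoc (s₀ : Fin 3) {t : ℕ} (y : Fin t → Fin 3) (a : Fin 3) :
    after s₀ (t + 1) (Fin.snoc (α := fun _ => Fin 3) y a) = (after s₀ t y).step a := by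
  simp [after]

/-- The test distribution of the next output. -/
noncomputable def testProb (p : ℝ) (v : IsingNode) (y : Fin 3) : ℝ :=
  if v.2 then (if y = v.1 then 2 * p / (1 + p) else (1 - p) / (2 * (1 + p)))
  else (if y = v.1 then (1 + p) / 2 else (1 - p) / 4)

/-- The relative value of the channel state `s` at a node. -/
noncomputable def value (p : ℝ) (v : IsingNode) (s : Fin 3) : ℝ :=
  if v.2 then
    (if s = v.1 then - Real.log p / 2 + Real.log (1 + p) - Real.log 2
      else - Real.log p / 4 + Real.log (1 + p))
  else (if s = v.1 then 0 else Real.log 2 - Real.log p / 4)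

theorem testProb_pos {p : ℝ} (h0 : 0 < p) (h1 : p < 1) (v : IsingNode) (y : Fin 3) :
    0 < testProb p v y := by
  have : 0 < 1 - p := by linarith
  unfold testProb
  split_ifs <;> positivity

theorem sum_testProb {p : ℝ} (h0 : 0 < p) (v : IsingNode) : ∑ y, testProb p v y = 1 := by
  have h : 1 + p ≠ 0 := by positivity
  obtain ⟨r, w⟩ := v
  fin_cases r <;> cases w <;> simp [testProb, Fin.sum_univ_three] <;> field_simp <;> ring

theorem log_one_sub {p : ℝ} (h0 : 0 < p) (h1 : p < 1) (hp : 16 * p ^ 3 = (1 - p) ^ 4) :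
    Real.log (1 - p) = Real.log 2 + 3 / 4 * Real.log p := by
  have h2 : (0 : ℝ) < 1 - p := by linarith
  have h := congrArg Real.log hp
  rw [Real.log_mul (by norm_num) (by positivity), Real.log_pow, Real.log_pow,
    show (16 : ℝ) = 2 ^ 4 by norm_num, Real.log_pow] at h
  push_cast at h
  linarith

theorem log_testProb {p : ℝ} (h0 : 0 < p) (h1 : p < 1) (hp : 16 * p ^ 3 = (1 - p) ^ 4)
    (v : IsingNode) (y : Fin 3) :
    Real.log (testProb p v y) =
      if v.2 then (if y = v.1 then Real.log 2 + Real.log p - Real.log (1 + p)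
        else 3 / 4 * Real.log p - Real.log (1 + p))
      else (if y = v.1 then Real.log (1 + p) - Real.log 2
        else 3 / 4 * Real.log p - Real.log 2) := by
  have h2 : (0 : ℝ) < 1 - p := by linarith
  have h4 : Real.log 4 = 2 * Real.log 2 := by
    rw [show (4 : ℝ) = 2 ^ 2 by norm_num, Real.log_pow]; norm_num
  unfold testProb
  split_ifs
  · rw [Real.log_div (by positivity) (by positivity), Real.log_mul (by positivity) (by positivity)]
  · rw [Real.log_div (by positivity) (by positivity), Real.log_mul (by positivity) (by positivity),
      log_one_sub h0 h1 hp]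
    ring
  · rw [Real.log_div (by positivity) (by positivity)]
  · rw [Real.log_div (by positivity) (by positivity), log_one_sub h0 h1 hp, h4]
    ring

/-- Equality holds for the moves of the scheme: any input from the known state, and repetition at an
ambiguous node. The other cases follow from `p ≥ 1 / 16`; for instance, returning to `r` from a
state other than `r` at an ambiguous node needs exactly `-log p / 4 ≤ log 2`. -/
theorem bellman {p : ℝ} (h0 : 1 / 16 ≤ p) (h1 : p < 1) (hp : 16 * p ^ 3 = (1 - p) ^ 4)
    (v : IsingNode) (x s : Fin 3) :
    ∑ y, (ising (Fin 3)).prob x s y * (Real.log ((ising (Fin 3)).prob x s y)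
      - Real.log (testProb p v y) + value p (v.step y) x) ≤ - Real.log p / 2 + value p v s := by
  have hpos : 0 < p := by linarith
  have hl2 : 0 < Real.log 2 := Real.log_pos (by norm_num)
  have hlp : - (4 * Real.log 2) ≤ Real.log p := by
    have h := Real.log_le_log (by norm_num) h0
    rw [show (1 / 16 : ℝ) = (2 ^ 4)⁻¹ by norm_num, Real.log_inv, Real.log_pow] at h
    push_cast at h
    exact h
  simp only [log_testProb hpos h1 hp]
  obtain ⟨r, w⟩ := v
  -- If `x = s`, the two halves of the output probability fall on one letter, and its logarithm must
  -- simplify to 0.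
  have hhalf : (2 : ℝ)⁻¹ + 2⁻¹ = 1 := by norm_num
  fin_cases r <;> cases w <;> fin_cases x <;> fin_cases s <;>
    simp [ising, value, step, Fin.sum_univ_three, hhalf] <;> linarith

end IsingNode

end UnifilarFSC

/-! ### The optimal parameter and the maximal rate -/

theorem exists_root_of_optimality :
    ∃ p : ℝ, 0.26380532 ≤ p ∧ p ≤ 0.26380534 ∧ 16 * p ^ 3 = (1 - p) ^ 4 := by
  have hc : ContinuousOn (fun p : ℝ => 16 * p ^ 3 - (1 - p) ^ 4)
      (Set.Icc 0.26380532 0.26380534) := by fun_prop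
  obtain ⟨p, hp, h⟩ := intermediate_value_Icc (by norm_num) hc
    (show (0 : ℝ) ∈ Set.Icc _ _ by constructor <;> norm_num)
  exact ⟨p, hp.1, hp.2, sub_eq_zero.1 h⟩

theorem log_root_bounds {p : ℝ} (h1 : 0.26380532 ≤ p) (h2 : p ≤ 0.26380534) :
    |- Real.log p / 2 / Real.log 2 - 0.961227| ≤ 5e-7 := by
  have hl1 := Real.log_two_gt_d9
  have hl2 := Real.log_two_lt_d9
  have h4 : Real.log 4 = 2 * Real.log 2 := by
    rw [show (4 : ℝ) = 2 ^ 2 by norm_num, Real.log_pow]; norm_num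
  have hlo := Real.log_le_log (by norm_num) h1
  have hhi := Real.log_le_log (by linarith) h2
  -- Since `4 p` is close to 1, six terms of the series of `log (4 p)` suffice.
  have ha := Real.abs_log_sub_add_sum_range_le (x := 1 - 4 * 0.26380532)
    (by rw [abs_lt]; constructor <;> norm_num) 6
  have hb := Real.abs_log_sub_add_sum_range_le (x := 1 - 4 * 0.26380534)
    (by rw [abs_lt]; constructor <;> norm_num) 6
  rw [sub_sub_cancel, Real.log_mul (by norm_num) (by norm_num), h4, abs_le] at ha hb
  norm_num [Finset.sum_range_succ, abs_of_neg] at ha hb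
  have hl : 0 < Real.log 2 := by linarith
  norm_num at hlo hhi
  rw [abs_le]
  constructor
  · have h : 0.961227 - 5e-7 ≤ - Real.log p / 2 / Real.log 2 := by
      rw [le_div_iff₀ hl]
      norm_num
      linarith [hb.2]
    linarith
  · have h : - Real.log p / 2 / Real.log 2 ≤ 0.961227 + 5e-7 := by
      rw [div_le_iff₀ hl]
      norm_num
      linarith [ha.1]
    linarith

/-- Gibbs' inequality for two points. -/
theorem binEntropy_le_cross {p q : ℝ} (hp0 : 0 < p) (hp1 : p < 1) (hq : q ∈ Set.Icc (0 : ℝ) 1) :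
    Real.binEntropy q ≤ - q * Real.log p - (1 - q) * Real.log (1 - p) := by
  have h1 := UnifilarFSC.mul_log_div_ge hq.1 hp0 one_pos
  have h2 := UnifilarFSC.mul_log_div_ge (sub_nonneg.2 hq.2) (sub_pos.2 hp1) one_pos
  simp only [Real.binEntropy, Real.log_inv]
  rw [Real.log_one] at h1 h2
  linarith

/-- Inserting `log (1 - p)` into Gibbs' inequality bounds `H(q) + (1 - q) log 2` by `-(q + 3) log p
/ 4`, so the denominator cancels. Gibbs is tight at `q = p`. -/
theorem ising3Rate_le {p q : ℝ} (hp0 : 0 < p) (hp1 : p < 1) (hp : 16 * p ^ 3 = (1 - p) ^ 4)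
    (hq : q ∈ Set.Icc (0 : ℝ) 1) : ising3Rate q ≤ - Real.log p / 2 / Real.log 2 := by
  have hl : 0 < Real.log 2 := Real.log_pos (by norm_num)
  have hq3 : 0 < q + 3 := by linarith [hq.1]
  have h := binEntropy_le_cross hp0 hp1 hq
  rw [UnifilarFSC.IsingNode.log_one_sub hp0 hp1 hp] at h
  unfold ising3Rate binEntropyBits
  rw [le_div_iff₀ hl, show 2 * ((Real.binEntropy q / Real.log 2 + 1 - q) / (q + 3)) * Real.log 2
    = 2 * (Real.binEntropy q + (1 - q) * Real.log 2) / (q + 3) by field_simp; ring,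
    div_le_iff₀ hq3]
  linarith

theorem ising3Rate_eq {p : ℝ} (hp0 : 0 < p) (hp1 : p < 1) (hp : 16 * p ^ 3 = (1 - p) ^ 4) :
    ising3Rate p = - Real.log p / 2 / Real.log 2 := by
  have hl : 0 < Real.log 2 := Real.log_pos (by norm_num)
  have hq3 : 0 < p + 3 := by linarith
  unfold ising3Rate binEntropyBits
  rw [eq_div_iff hl.ne', show 2 * ((Real.binEntropy p / Real.log 2 + 1 - p) / (p + 3)) * Real.log 2
    = 2 * (Real.binEntropy p + (1 - p) * Real.log 2) / (p + 3) by field_simp; ring,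
    div_eq_iff hq3.ne', Real.binEntropy, Real.log_inv, Real.log_inv,
    UnifilarFSC.IsingNode.log_one_sub hp0 hp1 hp]
  ring

/-! ### The converse -/

namespace UnifilarFSC

namespace IsingNode

/-- The test distribution of the first `t` outputs. -/
noncomputable def testSeqProb (p : ℝ) (s₀ : Fin 3) : (t : ℕ) → (Fin t → Fin 3) → ℝ
  | 0, _ => 1
  | t + 1, y =>
      testSeqProb p s₀ t (Fin.init y) * testProb p (after s₀ t (Fin.init y)) (y (Fin.last t))

theorem testSeqProb_snoc (p : ℝ) (s₀ : Fin 3) {t : ℕ} (y : Fin t → Fin 3) (a : Fin 3) :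
    testSeqProb p s₀ (t + 1) (Fin.snoc (α := fun _ => Fin 3) y a) =
      testSeqProb p s₀ t y * testProb p (after s₀ t y) a := by
  simp [testSeqProb]

theorem testSeqProb_pos {p : ℝ} (h0 : 0 < p) (h1 : p < 1) (s₀ : Fin 3) :
    ∀ (t : ℕ) (y : Fin t → Fin 3), 0 < testSeqProb p s₀ t y
  | 0, _ => zero_lt_one
  | t + 1, _ => mul_pos (testSeqProb_pos h0 h1 s₀ t _) (testProb_pos h0 h1 _ _)

theorem sum_testSeqProb {p : ℝ} (h0 : 0 < p) (s₀ : Fin 3) (n : ℕ) :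
    ∑ y, testSeqProb p s₀ n y = 1 := by
  induction n with
  | zero => simp [testSeqProb]
  | succ n ih =>
    rw [sum_fin_succ_eq_sum_snoc, ← ih]
    refine Finset.sum_congr rfl fun y _ => ?_
    simp only [testSeqProb_snoc]
    rw [← Finset.mul_sum, sum_testProb h0, mul_one]

theorem neg_log_two_le_value {p : ℝ} (h0 : 0 < p) (h1 : p < 1) (v : IsingNode) (s : Fin 3) :
    - Real.log 2 ≤ value p v s := by
  have hl2 : 0 < Real.log 2 := Real.log_pos (by norm_num)
  have hlp : Real.log p < 0 := Real.log_neg h0 h1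
  have hlp' : 0 < Real.log (1 + p) := Real.log_pos (by linarith)
  unfold value
  split_ifs <;> linarith

/-- The divergence of the outputs of any strategy from the test distribution. -/
theorem divergence_le {p : ℝ} (h0 : 1 / 16 ≤ p) (h1 : p < 1) (hp : 16 * p ^ 3 = (1 - p) ^ 4)
    (s₀ : Fin 3) (f : Strategy (Fin 3) (Fin 3)) (n : ℕ) :
    ∑ y, (ising (Fin 3)).outputProb s₀ f n y *
      (Real.log ((ising (Fin 3)).outputProb s₀ f n y) - Real.log (testSeqProb p s₀ n y)) ≤
      n * (- Real.log p / 2) + Real.log 2 := by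
  have hpos : 0 < p := by linarith
  set ch := ising (Fin 3) with hch
  set c := - Real.log p / 2 with hc
  -- The supermartingale is the log-likelihood ratio plus the value of the current state minus the
  -- accumulated gain.
  have h := sum_outputProb_mul_le ch s₀ f (fun t y => Real.log (ch.outputProb s₀ f t y)
    - Real.log (testSeqProb p s₀ t y) + value p (after s₀ t y) (ch.stateAfter s₀ f t y) - t * c)
    (by
      intro t y hy
      have hb := bellman h0 h1 hp (after s₀ t y) (f t y) (ch.stateAfter s₀ f t y)
      set x := f t y
      set s := ch.stateAfter s₀ f t y with hs
      set A := Real.log (ch.outputProb s₀ f t y) - Real.log (testSeqProb p s₀ t y) - (t + 1) * c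
        with hA
      have hterm : ∀ a, ch.prob x s a *
          (Real.log (ch.outputProb s₀ f (t + 1) (Fin.snoc (α := fun _ => Fin 3) y a))
          - Real.log (testSeqProb p s₀ (t + 1) (Fin.snoc (α := fun _ => Fin 3) y a))
          + value p (after s₀ (t + 1) (Fin.snoc (α := fun _ => Fin 3) y a))
            (ch.stateAfter s₀ f (t + 1) (Fin.snoc (α := fun _ => Fin 3) y a))
          - ((t + 1 : ℕ) : ℝ) * c) = ch.prob x s a * A +
          ch.prob x s a * (Real.log (ch.prob x s a) - Real.log (testProb p (after s₀ t y) a)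
            + value p ((after s₀ t y).step a) x) := by
        intro a
        -- Impossible outputs have weight 0, so the conventional value of `log 0` does no harm.
        by_cases ha : ch.prob x s a = 0
        · simp [ha]
        · have hnext : ch.stateAfter s₀ f (t + 1) (Fin.snoc (α := fun _ => Fin 3) y a) = x := by
            rw [stateAfter_snoc]; rfl
          rw [hnext, outputProb_snoc, testSeqProb_snoc, after_snoc, Real.log_mul hy ha,
            Real.log_mul (testSeqProb_pos hpos h1 s₀ t y).ne' (testProb_pos hpos h1 _ _).ne', hA]
          push_cast
          ring
      rw [Finset.sum_congr rfl fun a _ => hterm a, Finset.sum_add_distrib, ← Finset.sum_mul,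
        ch.prob_sum, one_mul]
      linarith) n
  have h00 : value p (after s₀ 0 Fin.elim0) (ch.stateAfter s₀ f 0 Fin.elim0) = 0 := by
    simp [value, after, stateAfter]
  simp only [h00, outputProb, testSeqProb, Real.log_one, Nat.cast_zero] at h
  have hP1 := sum_outputProb ch s₀ f n
  have hle : ∑ y, ch.outputProb s₀ f n y *
      (Real.log (ch.outputProb s₀ f n y) - Real.log (testSeqProb p s₀ n y)) +
      (∑ y, ch.outputProb s₀ f n y) * (- Real.log 2 - n * c) ≤ 0 := by
    refine le_trans ?_ (h.trans (by simp))
    rw [Finset.sum_mul, ← Finset.sum_add_distrib]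
    refine Finset.sum_le_sum fun y _ => ?_
    rw [← mul_add]
    refine mul_le_mul_of_nonneg_left ?_ (outputProb_nonneg ch s₀ f n y)
    linarith [neg_log_two_le_value hpos h1 (after s₀ n y) (ch.stateAfter s₀ f n y)]
  rw [hP1] at hle
  linarith

end IsingNode

theorem ising_converse {p : ℝ} (h0 : 1 / 16 ≤ p) (h1 : p < 1) (hp : 16 * p ^ 3 = (1 - p) ^ 4)
    (s₀ : Fin 3) {R : ℝ} (hR : (ising (Fin 3)).IsAchievable s₀ R) :
    R ≤ - Real.log p / 2 / Real.log 2 := by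
  have hpos : 0 < p := by linarith
  have hl2 : 0 < Real.log 2 := Real.log_pos (by norm_num)
  obtain ⟨c, hc⟩ := hR
  rcases le_or_gt R 0 with hR0 | hR0
  · exact hR0.trans (div_nonneg (by linarith [Real.log_neg hpos h1]) hl2.le)
  rw [le_div_iff₀ hl2]
  have hlim1 : Tendsto (fun n => (1 - (ising (Fin 3)).errorProb s₀ (c n)) * (R * Real.log 2))
      atTop (𝓝 (R * Real.log 2)) := by
    simpa using (tendsto_const_nhds (x := (1 : ℝ)).sub hc).mul_const (R * Real.log 2)
  have hlim2 : Tendsto (fun n : ℕ => - Real.log p / 2 + (Real.log 2 + 1) / n)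
      atTop (𝓝 (- Real.log p / 2)) := by
    simpa using tendsto_const_nhds.add (tendsto_const_div_atTop_nhds_zero_nat (Real.log 2 + 1))
  have hlim3 : ∀ᶠ n in atTop, (ising (Fin 3)).errorProb s₀ (c n) < 1 :=
    hc.eventually (gt_mem_nhds one_pos)
  refine le_of_tendsto_of_tendsto hlim1 hlim2 ?_
  filter_upwards [hlim3, eventually_gt_atTop 0] with n hn hn0
  have hn0' : (0 : ℝ) < n := by exact_mod_cast hn0
  have h2 : (0 : ℝ) < 2 ^ ((n : ℝ) * R) := by positivity
  have hM := one_sub_errorProb_mul_log_le (ising (Fin 3)) s₀ (Nat.ceil_pos.2 h2) (c n)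
    (IsingNode.testSeqProb p s₀ n) (IsingNode.testSeqProb_pos hpos h1 s₀ n)
    (IsingNode.sum_testSeqProb hpos s₀ n) _ (fun f => IsingNode.divergence_le h0 h1 hp s₀ f n)
  have hlog : n * (R * Real.log 2) ≤ Real.log ⌈(2 : ℝ) ^ ((n : ℝ) * R)⌉₊ := by
    rw [← mul_assoc, ← Real.log_rpow (by norm_num)]
    exact Real.log_le_log h2 (Nat.le_ceil _)
  have h3 := mul_le_mul_of_nonneg_left hlog (sub_nonneg.2 hn.le)
  refine le_of_mul_le_mul_left ?_ hn0'
  have h4 : n * (- Real.log p / 2 + (Real.log 2 + 1) / n) =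
      n * (- Real.log p / 2) + Real.log 2 + 1 := by field_simp; ring
  rw [h4]
  linarith

end UnifilarFSC

/-! ### The coding scheme and its decoding time -/

namespace UnifilarFSC

theorem sum_ising_prob_mul (x s : Fin 3) (F : Fin 3 → ℝ) :
    ∑ a, (ising (Fin 3)).prob x s a * F a = F x / 2 + F s / 2 := by
  simp only [ising, add_mul, Finset.sum_add_distrib]
  simp
  ring

theorem ising_prob_ne_zero {x s a : Fin 3} (h : (ising (Fin 3)).prob x s a ≠ 0) :
    a = x ∨ a = s := by
  by_contra! hc
  simp [ising, hc.1, hc.2] at h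

namespace IsingNode

/-- The increments of the known states that the decoder reads off the outputs `y`. -/
def decoded (s₀ : Fin 3) : (t : ℕ) → (Fin t → Fin 3) → List (Fin 3)
  | 0, _ => []
  | t + 1, y =>
      if y (Fin.last t) = (after s₀ t (Fin.init y)).1 ∧ (after s₀ t (Fin.init y)).2 = false then
        decoded s₀ t (Fin.init y)
      else decoded s₀ t (Fin.init y) ++ [y (Fin.last t) - (after s₀ t (Fin.init y)).1]

theorem decoded_snoc (s₀ : Fin 3) {t : ℕ} (y : Fin t → Fin 3) (a : Fin 3) :
    decoded s₀ (t + 1) (Fin.snoc (α := fun _ => Fin 3) y a) =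
      if a = (after s₀ t y).1 ∧ (after s₀ t y).2 = false then decoded s₀ t y
      else decoded s₀ t y ++ [a - (after s₀ t y).1] := by
  simp [decoded]

/-- The strategy that moves the known state by the increments `d 0, d 1, …`, and repeats an input
if the decoder could not tell it from the state. -/
def send (s₀ : Fin 3) (d : ℕ → Fin 3) : Strategy (Fin 3) (Fin 3) := fun t y =>
  (after s₀ t y).1 + d (decoded s₀ t y).length

/-- The channel state at the node `v`, if the next increment is `e`. -/
def stateAt (v : IsingNode) (e : Fin 3) : Fin 3 := if v.2 then v.1 + e else v.1

/-- An output is the input or the state. At a known node, an output other than `r` must be the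
input; at an ambiguous node the input repeats the state. Hence everything the decoder appends is
correct. -/
theorem send_invariant (s₀ : Fin 3) (d : ℕ → Fin 3) : ∀ (t : ℕ) (y : Fin t → Fin 3),
    (ising (Fin 3)).outputProb s₀ (send s₀ d) t y ≠ 0 →
      decoded s₀ t y = (List.range (decoded s₀ t y).length).map d ∧
      (ising (Fin 3)).stateAfter s₀ (send s₀ d) t y =
        stateAt (after s₀ t y) (d (decoded s₀ t y).length)
  | 0, y => fun _ => by simp [decoded, stateAfter, stateAt, after]
  | t + 1, y => by
    obtain ⟨y, a, rfl⟩ : ∃ (y' : Fin t → Fin 3) (a : Fin 3),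
        y = Fin.snoc (α := fun _ => Fin 3) y' a := ⟨_, _, (Fin.snoc_init_self y).symm⟩
    intro h
    rw [outputProb_snoc] at h
    obtain ⟨ih1, ih2⟩ := send_invariant s₀ d t y (left_ne_zero_of_mul h)
    have ha := ising_prob_ne_zero (right_ne_zero_of_mul h)
    have hnext : (ising (Fin 3)).stateAfter s₀ (send s₀ d) (t + 1)
        (Fin.snoc (α := fun _ => Fin 3) y a) = send s₀ d t y := by
      rw [stateAfter_snoc]; rfl
    rw [hnext, decoded_snoc, after_snoc]
    rw [ih2] at ha
    unfold send at ha ⊢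
    unfold stateAt at ha ⊢
    unfold step
    by_cases hcond : a = (after s₀ t y).1 ∧ (after s₀ t y).2 = false
    · rw [if_pos hcond, if_pos hcond]
      exact ⟨ih1, by simp⟩
    · rw [if_neg hcond, if_neg hcond]
      have hax : a = (after s₀ t y).1 + d (decoded s₀ t y).length := by
        rcases ha with ha | ha
        · exact ha
        · by_cases hw : (after s₀ t y).2
          · simpa [hw] using ha
          · simp only [hw] at ha
            exact absurd ⟨ha, by simpa using hw⟩ hcond
      constructor
      · rw [List.length_append, List.length_singleton, List.range_succ, List.map_append, ← ih1, hax]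
        simp
      · simp [hax]

/-- The moment generating function of the time that the increment `e` takes. -/
noncomputable def timeMGF (lam : ℝ) (e : Fin 3) : ℝ :=
  if e = 0 then Real.exp lam * Real.exp lam
  else (Real.exp lam + Real.exp lam * Real.exp lam) / 2

/-- The moment generating function of the time that remains until `k` increments are decoded,
where `i` increments are decoded, and `0` if none remain. -/
noncomputable def remainingMGF (lam : ℝ) (d : ℕ → Fin 3) (k i : ℕ) (w : Bool) : ℝ :=
  if i < k then
    (if w then Real.exp lam * ∏ l ∈ Finset.Ico (i + 1) k, timeMGF lam (d l)
      else ∏ l ∈ Finset.Ico i k, timeMGF lam (d l))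
  else 0

theorem one_le_timeMGF {lam : ℝ} (h : 0 ≤ lam) (e : Fin 3) : 1 ≤ timeMGF lam e := by
  have := Real.one_le_exp h
  unfold timeMGF
  split_ifs <;> nlinarith

theorem one_le_prod_timeMGF {lam : ℝ} (h : 0 ≤ lam) (d : ℕ → Fin 3) (i k : ℕ) :
    1 ≤ ∏ l ∈ Finset.Ico i k, timeMGF lam (d l) :=
  Finset.one_le_prod fun l _ => one_le_timeMGF h (d l)

theorem remainingMGF_nonneg {lam : ℝ} (h : 0 ≤ lam) (d : ℕ → Fin 3) (k i : ℕ) (w : Bool) :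
    0 ≤ remainingMGF lam d k i w := by
  have h1 := one_le_prod_timeMGF h d i k
  have h2 := one_le_prod_timeMGF h d (i + 1) k
  unfold remainingMGF
  split_ifs <;> positivity

theorem one_le_remainingMGF {lam : ℝ} (h : 0 ≤ lam) (d : ℕ → Fin 3) {k i : ℕ} (hi : i < k)
    (w : Bool) : 1 ≤ remainingMGF lam d k i w := by
  have h1 := one_le_prod_timeMGF h d i k
  have h2 := one_le_prod_timeMGF h d (i + 1) k
  have h3 := Real.one_le_exp h
  unfold remainingMGF
  rw [if_pos hi]
  split_ifs
  · exact one_le_mul_of_one_le_of_one_le h3 h2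
  · exact h1

theorem remainingMGF_false_le {lam : ℝ} (h : 0 ≤ lam) (d : ℕ → Fin 3) (k i : ℕ) :
    remainingMGF lam d k i false ≤ ∏ l ∈ Finset.Ico i k, timeMGF lam (d l) := by
  have h1 := one_le_prod_timeMGF h d i k
  unfold remainingMGF
  split_ifs
  · simp_all
  · simp
  · positivity

/-- One step of the process of decoded increments. -/
theorem remainingMGF_step {lam : ℝ} (h : 0 ≤ lam) (d : ℕ → Fin 3) (k : ℕ) (v : IsingNode)
    (L : List (Fin 3)) :
    let G : Fin 3 → ℝ := fun a => remainingMGF lam d k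
      (if a = v.1 ∧ v.2 = false then L else L ++ [a - v.1]).length (v.step a).2
    Real.exp lam * (G (v.1 + d L.length) / 2 + G (stateAt v (d L.length)) / 2) ≤
      remainingMGF lam d k L.length v.2 := by
  intro G
  obtain ⟨r, w⟩ := v
  have hexp := Real.exp_pos lam
  by_cases hi : L.length < k
  · have h2 := one_le_prod_timeMGF h d (L.length + 1) k
    have hP := remainingMGF_false_le h d k (L.length + 1)
    set P := ∏ l ∈ Finset.Ico (L.length + 1) k, timeMGF lam (d l) with hPdef
    cases w
    · have hG0 : G r = Real.exp lam * P := by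
        simp [G, step, remainingMGF, hi, hPdef]
      have hF : remainingMGF lam d k L.length false = timeMGF lam (d L.length) * P := by
        simp only [remainingMGF, hi, if_true]
        rw [Finset.prod_eq_prod_Ico_succ_bot hi]
        simp [hPdef]
      rw [hF]
      by_cases hd : d L.length = 0
      · simp only [hd, stateAt, timeMGF]
        simp only [add_zero, hG0]
        simp only [Bool.false_eq_true, if_false, if_true, hG0]
        linarith
      -- Only an inequality, because `remainingMGF` drops to 0 when the last increment is decoded.
      · have hG1 : G (r + d L.length) ≤ P := by
          simpa [G, step, hd] using hP
        simp only [stateAt, timeMGF, hd, Bool.false_eq_true, if_false, hG0]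
        nlinarith
    · have hG1 : G (r + d L.length) ≤ P := by
        simpa [G, step] using hP
      simp only [stateAt, if_true]
      simp only [remainingMGF, hi, if_true]
      nlinarith
  · have hG : ∀ a, G a = 0 := by
      intro a
      simp only [G, remainingMGF]
      rw [if_neg]
      split_ifs
      · exact hi
      · simp; omega
    simp only [hG, remainingMGF, hi, if_false]
    simp

/-- Chernoff bound for the probability that fewer than `k` increments are decoded by time `n`. -/
theorem sum_outputProb_short_le {lam : ℝ} (h : 0 ≤ lam) (s₀ : Fin 3) (d : ℕ → Fin 3) (k n : ℕ) :
    Real.exp (lam * n) * ∑ y, (if (decoded s₀ n y).length < k then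
      (ising (Fin 3)).outputProb s₀ (send s₀ d) n y else 0) ≤
      ∏ l ∈ Finset.Ico 0 k, timeMGF lam (d l) := by
  have hsup := sum_outputProb_mul_le (ising (Fin 3)) s₀ (send s₀ d)
    (fun t y => Real.exp (lam * t) *
      remainingMGF lam d k (decoded s₀ t y).length (after s₀ t y).2) (by
      intro t y hy
      obtain ⟨-, h2⟩ := send_invariant s₀ d t y hy
      rw [sum_ising_prob_mul, h2]
      simp only [decoded_snoc, after_snoc]
      have hstep := remainingMGF_step h d k (after s₀ t y) (decoded s₀ t y)
      simp only at hstep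
      have := mul_le_mul_of_nonneg_left hstep (Real.exp_pos (lam * t)).le
      refine le_trans (le_of_eq ?_) this
      have he : Real.exp (lam * ((t + 1 : ℕ) : ℝ)) = Real.exp (lam * t) * Real.exp lam := by
        rw [← Real.exp_add]; push_cast; ring_nf
      rw [he]
      unfold send
      ring) n
  refine le_trans ?_ (hsup.trans ?_)
  · rw [Finset.mul_sum]
    refine Finset.sum_le_sum fun y _ => ?_
    have hP := outputProb_nonneg (ising (Fin 3)) s₀ (send s₀ d) n y
    have hE := Real.exp_pos (lam * n)
    split_ifs with hk
    -- Markov's inequality: the function is at least 1 on unfinished words and nonnegative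
    -- elsewhere.
    · have := one_le_remainingMGF h d hk (after s₀ n y).2
      rw [mul_comm]
      exact mul_le_mul_of_nonneg_left (le_mul_of_one_le_right hE.le this) hP
    · have := remainingMGF_nonneg h d k (decoded s₀ n y).length (after s₀ n y).2
      rw [mul_zero]
      positivity
  · simpa [decoded, after] using remainingMGF_false_le h d k 0

end IsingNode

end UnifilarFSC

/-! ### Counting words with a prescribed number of zeros -/

/-- The Poisson weight `a ^ i / i!` is largest at `i = a`. -/
theorem factorial_mul_pow_le_factorial_mul_pow (a i : ℕ) :
    a.factorial * a ^ i ≤ i.factorial * a ^ a := by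
  rcases le_total a i with h | h
  · calc a.factorial * a ^ i = a.factorial * a ^ (i - a) * a ^ a := by
          rw [mul_assoc, ← pow_add, Nat.sub_add_cancel h]
      _ ≤ _ := Nat.mul_le_mul_right _ (Nat.factorial_mul_pow_sub_le_factorial h)
  · have h1 := Nat.factorial_mul_descFactorial (Nat.sub_le a i)
    rw [Nat.sub_sub_self h] at h1
    calc a.factorial * a ^ i = i.factorial * (a.descFactorial (a - i) * a ^ i) := by
          rw [← h1, mul_assoc]
      _ ≤ i.factorial * (a ^ (a - i) * a ^ i) :=
          Nat.mul_le_mul_left _ (Nat.mul_le_mul_right _ (Nat.descFactorial_le_pow _ _))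
      _ = _ := by rw [← pow_add, Nat.sub_add_cancel h]

/-- The mode of the binomial distribution with parameters `k` and `j / k` is `j`. -/
theorem choose_mul_pow_mul_pow_le {k i j : ℕ} (hi : i ≤ k) (hj : j ≤ k) :
    k.choose i * (j ^ i * (k - j) ^ (k - i)) ≤ k.choose j * (j ^ j * (k - j) ^ (k - j)) := by
  have h1 := factorial_mul_pow_le_factorial_mul_pow j i
  have h2 := factorial_mul_pow_le_factorial_mul_pow (k - j) (k - i)
  have h3 := Nat.choose_mul_factorial_mul_factorial hi
  have h4 := Nat.choose_mul_factorial_mul_factorial hj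
  have hpos : 0 < j.factorial * (k - j).factorial :=
    Nat.mul_pos (Nat.factorial_pos _) (Nat.factorial_pos _)
  refine Nat.le_of_mul_le_mul_right ?_ hpos
  calc k.choose i * (j ^ i * (k - j) ^ (k - i)) * (j.factorial * (k - j).factorial)
      = k.choose i * ((j.factorial * j ^ i) * ((k - j).factorial * (k - j) ^ (k - i))) := by ring
    _ ≤ k.choose i * ((i.factorial * j ^ j) * ((k - i).factorial * (k - j) ^ (k - j))) :=
        Nat.mul_le_mul_left _ (Nat.mul_le_mul h1 h2)
    _ = (k.choose i * i.factorial * (k - i).factorial) * (j ^ j * (k - j) ^ (k - j)) := by ring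
    _ = (k.choose j * j.factorial * (k - j).factorial) * (j ^ j * (k - j) ^ (k - j)) := by
        rw [h3, h4]
    _ = _ := by ring

/-- The binomial expansion of `(j + (k - j)) ^ k` has `k + 1` terms, of which the `j`-th is the
largest. -/
theorem pow_self_le_succ_mul_choose {k j : ℕ} (hj : j ≤ k) :
    k ^ k ≤ (k + 1) * (k.choose j * (j ^ j * (k - j) ^ (k - j))) := by
  calc k ^ k = (j + (k - j)) ^ k := by rw [Nat.add_sub_cancel' hj]
    _ = ∑ i ∈ Finset.range (k + 1), k.choose i * (j ^ i * (k - j) ^ (k - i)) := by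
        rw [add_pow]
        exact Finset.sum_congr rfl fun i _ => by simp; ring
    _ ≤ ∑ _i ∈ Finset.range (k + 1), k.choose j * (j ^ j * (k - j) ^ (k - j)) :=
        Finset.sum_le_sum fun i hi =>
          choose_mul_pow_mul_pow_le (Nat.lt_succ_iff.1 (Finset.mem_range.1 hi)) hj
    _ = _ := by simp

theorem mul_binEntropy_le_log_choose {k j : ℕ} (hj0 : 0 < j) (hj : j < k) :
    k * Real.binEntropy (j / k) - Real.log (k + 1) ≤ Real.log (k.choose j) := by
  have hk : (0 : ℝ) < k := by exact_mod_cast hj0.trans hj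
  have hj0' : (0 : ℝ) < j := by exact_mod_cast hj0
  have hkj : (0 : ℝ) < k - j := sub_pos.2 (by exact_mod_cast hj)
  have hch : (0 : ℝ) < k.choose j := by exact_mod_cast Nat.choose_pos hj.le
  have h : ((k ^ k : ℕ) : ℝ) ≤ ((k + 1) * (k.choose j * (j ^ j * (k - j) ^ (k - j))) : ℕ) := by
    exact_mod_cast pow_self_le_succ_mul_choose hj.le
  push_cast [Nat.cast_sub hj.le] at h
  have h' := Real.log_le_log (by positivity) h
  rw [Real.log_mul (by positivity) (by positivity), Real.log_mul (by positivity) (by positivity),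
    Real.log_mul (by positivity) (by positivity), Real.log_pow, Real.log_pow, Real.log_pow,
    Nat.cast_sub hj.le] at h'
  have h1 : (1 : ℝ) - j / k = (k - j) / k := by field_simp
  rw [Real.binEntropy, Real.log_inv, Real.log_inv, h1, Real.log_div hj0'.ne' hk.ne',
    Real.log_div hkj.ne' hk.ne']
  have h2 : k * ((j : ℝ) / k * -(Real.log j - Real.log k) +
      (k - j) / k * -(Real.log (k - j) - Real.log k)) =
      k * Real.log k - j * Real.log j - (k - j) * Real.log (k - j) := by
    field_simp; ring
  rw [h2]
  linarith

/-- The number of ternary words of length `k` with exactly `j` zeros. -/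
theorem card_filter_card_zeros (k j : ℕ) :
    (Finset.univ.filter fun d : Fin k → Fin 3 =>
      (Finset.univ.filter fun i => d i = 0).card = j).card = k.choose j * 2 ^ (k - j) := by
  classical
  -- The words are grouped by their zero set `A`; each position outside `A` has two letters to
  -- choose from.
  rw [Finset.card_eq_sum_card_fiberwise (f := fun d : Fin k → Fin 3 =>
    Finset.univ.filter fun i => d i = 0) (t := Finset.powersetCard j Finset.univ)]
  · have h : ∀ A ∈ Finset.powersetCard j (Finset.univ : Finset (Fin k)),
        ((Finset.univ.filter fun d : Fin k → Fin 3 =>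
          (Finset.univ.filter fun i => d i = 0).card = j).filter fun d =>
            (Finset.univ.filter fun i => d i = 0) = A).card = 2 ^ (k - j) := by
      intro A hA
      rw [Finset.mem_powersetCard] at hA
      have heq : ((Finset.univ.filter fun d : Fin k → Fin 3 =>
          (Finset.univ.filter fun i => d i = 0).card = j).filter fun d =>
            (Finset.univ.filter fun i => d i = 0) = A) =
          Fintype.piFinset fun i => if i ∈ A then {0} else {1, 2} := by
        ext d
        simp only [Finset.mem_filter, Finset.mem_univ, true_and, Fintype.mem_piFinset]
        constructor
        · rintro ⟨-, rfl⟩ i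
          by_cases hi : d i = 0
          · simp [hi]
          · simp only [Finset.mem_filter, Finset.mem_univ, true_and, hi, if_false,
              Finset.mem_insert, Finset.mem_singleton]
            omega
        · intro hd
          have : (Finset.univ.filter fun i => d i = 0) = A := by
            ext i
            have := hd i
            by_cases hi : i ∈ A
            · simpa [hi] using this
            · simp only [hi, if_false, Finset.mem_insert, Finset.mem_singleton] at this
              simp only [Finset.mem_filter, Finset.mem_univ, true_and, hi, iff_false]
              omega
          exact ⟨by rw [this]; exact hA.2, this⟩
      rw [heq, Fintype.card_piFinset]
      have : ∀ i, (if i ∈ A then ({0} : Finset (Fin 3)) else {1, 2}).card =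
          if i ∈ A then 1 else 2 := by
        intro i; split_ifs <;> rfl
      simp only [this]
      rw [Finset.prod_ite]
      simp only [Finset.prod_const_one, one_mul, Finset.prod_const]
      rw [Finset.filter_not, Finset.card_sdiff_of_subset (Finset.filter_subset _ _)]
      simp [hA.2]
    rw [Finset.sum_congr rfl h]
    simp
  · intro d hd
    simpa using hd

/-! ### Codes and achievability -/

namespace UnifilarFSC

namespace IsingNode

/-- A nonzero increment contributes `exp (3λ/2) * cosh (λ/2)`, and `cosh (λ/2) ≤ exp (λ²/8)`; a zero
contributes exactly `exp (2λ)`. -/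
theorem prod_timeMGF_le {lam : ℝ} {k j : ℕ} (d : ℕ → Fin 3)
    (hd : ((Finset.Ico 0 k).filter fun i => d i = 0).card = j) (hj : j ≤ k) :
    ∏ l ∈ Finset.Ico 0 k, timeMGF lam (d l) ≤
      Real.exp (lam * ((3 * k + j) / 2) + lam ^ 2 / 8 * (k - j)) := by
  have hbound : (Real.exp lam + Real.exp lam * Real.exp lam) / 2 ≤
      Real.exp (3 / 2 * lam + lam ^ 2 / 8) := by
    have h := Real.cosh_le_exp_half_sq (lam / 2)
    have h2 : (Real.exp lam + Real.exp lam * Real.exp lam) / 2 =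
        Real.exp (3 / 2 * lam) * Real.cosh (lam / 2) := by
      rw [Real.cosh_eq, mul_div_assoc', mul_add, ← Real.exp_add, ← Real.exp_add, ← Real.exp_add]
      ring_nf
    rw [h2, Real.exp_add]
    refine mul_le_mul_of_nonneg_left (h.trans (le_of_eq ?_)) (Real.exp_pos _).le
    ring_nf
  unfold timeMGF
  rw [Finset.prod_ite]
  simp only [Finset.prod_const]
  rw [Finset.filter_not, Finset.card_sdiff_of_subset (Finset.filter_subset _ _), hd]
  simp only [Nat.card_Ico, Nat.sub_zero]
  calc _ ≤ (Real.exp lam * Real.exp lam) ^ j *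
        Real.exp (3 / 2 * lam + lam ^ 2 / 8) ^ (k - j) := by
        gcongr
    _ = _ := by
        rw [← Real.exp_add, ← Real.exp_nat_mul, ← Real.exp_nat_mul, ← Real.exp_add,
          Nat.cast_sub hj]
        ring_nf

end IsingNode

open IsingNode in
/-- Codes whose messages are the ternary words of length `k` with `j` zeros. -/
theorem exists_ising_code {M n k j : ℕ} (hM : 0 < M) (hj : j ≤ k)
    (hcard : M ≤ k.choose j * 2 ^ (k - j))
    {lam : ℝ} (hlam : 0 ≤ lam) (s₀ : Fin 3) :
    ∃ c : FeedbackCode (Fin 3) (Fin 3) M n, (ising (Fin 3)).errorProb s₀ c ≤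
      Real.exp (lam * ((3 * k + j) / 2 - n) + lam ^ 2 / 8 * (k - j)) := by
  classical
  have : Nonempty (Fin M) := ⟨⟨0, hM⟩⟩
  set T := Finset.univ.filter fun d : Fin k → Fin 3 =>
      (Finset.univ.filter fun i => d i = 0).card = j with hT
  obtain ⟨e⟩ : Nonempty (Fin M ↪ T) := by
    apply Function.Embedding.nonempty_of_card_le
    rw [Fintype.card_fin, Fintype.card_coe, hT, card_filter_card_zeros]
    exact hcard
  let w : Fin M → ℕ → Fin 3 := fun m l => if h : l < k then (e m : Fin k → Fin 3) ⟨l, h⟩ else 0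
  have hw : ∀ m, ((Finset.Ico 0 k).filter fun i => w m i = 0).card = j := by
    intro m
    rw [← (Finset.mem_filter.1 (e m).2).2]
    symm
    refine Finset.card_bij (fun i _ => (i : ℕ)) ?_ ?_ ?_
    · intro i hi
      simpa [w] using hi
    · intro a _ b _ h
      exact Fin.ext h
    · intro b hb
      rw [Finset.mem_filter, Finset.mem_Ico] at hb
      exact ⟨⟨b, hb.1.2⟩, by simpa [w, hb.1.2] using hb.2, rfl⟩
  -- Only the first `k` decoded increments are read; the default 0 matters only when fewer have been
  -- decoded, which is counted as an error.
  let read : List (Fin 3) → Fin k → Fin 3 := fun L l => L.getD l 0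
  let emb : Fin M → Fin k → Fin 3 := fun m => e m
  have hemb : Function.Injective emb := Subtype.val_injective.comp e.injective
  refine ⟨⟨fun m => send s₀ (w m), fun y => Function.invFun emb (read (decoded s₀ n y))⟩, ?_⟩
  have hM' : (0 : ℝ) < M := by exact_mod_cast hM
  unfold errorProb
  rw [div_le_iff₀ hM']
  set B := Real.exp (lam * ((3 * k + j) / 2 - n) + lam ^ 2 / 8 * (k - j)) with hB
  have key : ∀ m : Fin M, ∑ y : Fin n → Fin 3,
      (if Function.invFun emb (read (decoded s₀ n y)) = m then 0
        else (ising (Fin 3)).outputProb s₀ (send s₀ (w m)) n y) ≤ B := by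
    intro m
    have h1 := (sum_outputProb_short_le hlam s₀ (w m) k n).trans
      (prod_timeMGF_le (w m) (hw m) hj)
    have h2 : Real.exp (lam * ((3 * k + j) / 2) + lam ^ 2 / 8 * (k - j)) =
        Real.exp (lam * n) * B := by
      rw [hB, ← Real.exp_add]; ring_nf
    rw [h2] at h1
    refine le_trans (Finset.sum_le_sum fun y _ => ?_) (le_of_mul_le_mul_left h1 (Real.exp_pos _))
    have hP := outputProb_nonneg (ising (Fin 3)) s₀ (send s₀ (w m)) n y
    by_cases hk : (decoded s₀ n y).length < k
    · rw [if_pos hk]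
      split_ifs
      · exact hP
      · exact le_rfl
    · rw [if_neg hk]
      by_cases h0 : (ising (Fin 3)).outputProb s₀ (send s₀ (w m)) n y = 0
      · simp [h0]
      · have hdec := (send_invariant s₀ (w m) n y h0).1
        have hread : read (decoded s₀ n y) = emb m := by
          funext l
          have hl : (l : ℕ) < (decoded s₀ n y).length := by omega
          simp only [read, emb]
          rw [hdec]
          simp [hl, w]
        rw [hread, Function.leftInverse_invFun hemb m]
        simp
  calc _ ≤ ∑ _m : Fin M, B := Finset.sum_le_sum fun m _ => key m
    _ = B * M := by simp [mul_comm]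

end UnifilarFSC

namespace UnifilarFSC

theorem tendsto_log_succ_div {k : ℕ → ℕ} {a : ℝ} (hk : Tendsto k atTop atTop)
    (hka : Tendsto (fun n => (k n : ℝ) / n) atTop (𝓝 a)) :
    Tendsto (fun n => Real.log (k n + 1) / n) atTop (𝓝 0) := by
  have h1 : Tendsto (fun x : ℝ => Real.log x / x) atTop (𝓝 0) := by
    simpa using Real.isLittleO_log_id_atTop.tendsto_div_nhds_zero
  have hk1 : Tendsto (fun n => (k n : ℝ) + 1) atTop atTop :=
    tendsto_atTop_add_const_right _ _ (tendsto_natCast_atTop_atTop.comp hk)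
  have h2 : Tendsto (fun n => ((k n : ℝ) + 1) / n) atTop (𝓝 a) := by
    simpa [add_div] using hka.add tendsto_one_div_atTop_nhds_zero_nat
  have h3 := (h1.comp hk1).mul h2
  rw [zero_mul] at h3
  refine h3.congr fun n => ?_
  have : (k n : ℝ) + 1 ≠ 0 := by positivity
  simp only [Function.comp]
  field_simp

theorem ising_achievable {p R : ℝ} (hp0 : 0 < p) (hp1 : p < 1) (hR0 : 0 ≤ R)
    (hR : R < ising3Rate p) (s₀ : Fin 3) : (ising (Fin 3)).IsAchievable s₀ R := by
  have hl2 : 0 < Real.log 2 := Real.log_pos (by norm_num)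
  set C := ising3Rate p with hC
  have hC0 : 0 < C := hR0.trans_lt hR
  obtain ⟨ε, hε0, hε1, hε⟩ : ∃ ε : ℝ, 0 < ε ∧ ε < 1 ∧ R < (1 - ε) * C := by
    -- With this `ε`, the reduced rate `(1 - ε) * C` is the midpoint of `R` and `C`. Below, `a = lim
    -- k / n` is chosen so that the mean decoding time is at most `(1 - ε) * n`.
    refine ⟨(C - R) / (2 * C), by have := sub_pos.2 hR; positivity, ?_, ?_⟩
    · rw [div_lt_one (by positivity)]; linarith
    · have : (1 - (C - R) / (2 * C)) * C = (C + R) / 2 := by field_simp; ring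
      rw [this]; linarith
  set a := (1 - ε) * (2 / (3 + p)) with ha
  have hp3 : 0 < 3 + p := by linarith
  have ha0 : 0 < a := mul_pos (by linarith) (by positivity)
  have ha3 : a * ((3 + p) / 2) = 1 - ε := by rw [ha]; field_simp
  have ha1 : a ≤ 1 := by nlinarith
  let k : ℕ → ℕ := fun n => ⌊a * n⌋₊
  let j : ℕ → ℕ := fun n => ⌊p * k n⌋₊
  have hka : Tendsto (fun n => (k n : ℝ) / n) atTop (𝓝 a) :=
    (tendsto_nat_floor_mul_div_atTop ha0.le).comp tendsto_natCast_atTop_atTop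
  have hk : Tendsto k atTop atTop :=
    tendsto_nat_floor_atTop.comp (tendsto_natCast_atTop_atTop.const_mul_atTop ha0)
  have hjk : Tendsto (fun n => (j n : ℝ) / k n) atTop (𝓝 p) :=
    (tendsto_nat_floor_mul_div_atTop hp0.le).comp (tendsto_natCast_atTop_atTop.comp hk)
  have hH : Tendsto (fun n => (k n : ℝ) / n * (Real.binEntropy (j n / k n) +
      (1 - j n / k n) * Real.log 2) - Real.log (k n + 1) / n) atTop (𝓝 ((1 - ε) * C * Real.log 2)) := by
    have h := (hka.mul (((Real.binEntropy_continuous.tendsto p).comp hjk).add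
      ((tendsto_const_nhds (x := (1 : ℝ)).sub hjk).mul_const (Real.log 2)))).sub
      (tendsto_log_succ_div hk hka)
    convert! h using 2
    rw [ha, hC, ising3Rate, binEntropyBits]
    field_simp
    ring
  have hev : ∀ᶠ n : ℕ in atTop, ∃ c : FeedbackCode (Fin 3) (Fin 3) ⌈(2 : ℝ) ^ ((n : ℝ) * R)⌉₊ n,
      (ising (Fin 3)).errorProb s₀ c ≤ Real.exp (- (7 / 8 * ε ^ 2) * n) := by
    filter_upwards [hH.eventually (lt_mem_nhds (mul_lt_mul_of_pos_right hε hl2)),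
      eventually_gt_atTop 0, hjk.eventually (lt_mem_nhds hp0), hjk.eventually (gt_mem_nhds hp1),
      hk.eventually_gt_atTop 0] with n h1 hn hj0 hj1 hk0
    have hn' : (0 : ℝ) < n := by exact_mod_cast hn
    have hk0' : (0 : ℝ) < k n := by exact_mod_cast hk0
    have hjpos : 0 < j n := by
      rcases Nat.eq_zero_or_pos (j n) with h | h
      · simp [h] at hj0
      · exact h
    have hjlt : j n < k n := by
      rw [div_lt_one hk0'] at hj1
      exact_mod_cast hj1
    have hcount : (2 : ℝ) ^ ((n : ℝ) * R) ≤ ((k n).choose (j n) * 2 ^ (k n - j n) : ℕ) := by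
      have hch : (0 : ℝ) < (k n).choose (j n) := by exact_mod_cast Nat.choose_pos hjlt.le
      push_cast
      rw [← Real.log_le_log_iff (by positivity) (by positivity), Real.log_rpow (by norm_num),
        Real.log_mul hch.ne' (by positivity), Real.log_pow, Nat.cast_sub hjlt.le]
      have hb := mul_binEntropy_le_log_choose hjpos hjlt
      have h2 := mul_lt_mul_of_pos_left h1 hn'
      have h3 : n * ((k n : ℝ) / n * (Real.binEntropy (j n / k n) +
          (1 - j n / k n) * Real.log 2) - Real.log (k n + 1) / n) =
          k n * Real.binEntropy (j n / k n) + (k n - j n) * Real.log 2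
            - Real.log (k n + 1) := by
        field_simp
      rw [h3] at h2
      linarith
    -- The Chernoff parameter is `ε` itself: the slack gives `-ε² n` and the variance term at most
    -- `ε² n / 8`.
    obtain ⟨c, hc⟩ := exists_ising_code (n := n) (Nat.ceil_pos.2 (by positivity)) hjlt.le
      (Nat.ceil_le.2 hcount) hε0.le s₀
    refine ⟨c, hc.trans (Real.exp_le_exp.2 ?_)⟩
    have hkle : (k n : ℝ) ≤ a * n := Nat.floor_le (by positivity)
    have hjle : (j n : ℝ) ≤ p * k n := Nat.floor_le (by positivity)
    have hkn : (k n : ℝ) ≤ n := hkle.trans (mul_le_of_le_one_left hn'.le ha1)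
    have hj0' : (0 : ℝ) ≤ j n := Nat.cast_nonneg _
    have h4 : (3 * (k n : ℝ) + j n) / 2 ≤ (1 - ε) * n := by
      calc (3 * (k n : ℝ) + j n) / 2 ≤ (3 + p) / 2 * k n := by linarith
        _ ≤ (3 + p) / 2 * (a * n) := by gcongr
        _ = _ := by rw [← ha3]; ring
    have h5 : ε * ((3 * (k n : ℝ) + j n) / 2 - n) ≤ ε * (- (ε * n)) := by
      refine mul_le_mul_of_nonneg_left ?_ hε0.le
      linarith
    have h6 : ε ^ 2 / 8 * ((k n : ℝ) - j n) ≤ ε ^ 2 / 8 * n := by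
      refine mul_le_mul_of_nonneg_left ?_ (by positivity)
      linarith
    calc _ ≤ ε * (- (ε * n)) + ε ^ 2 / 8 * n := add_le_add h5 h6
      _ = _ := by ring
  -- A code is needed for every `n`; an arbitrary one is used where the bound is not available.
  have hall : ∀ n : ℕ, ∃ c : FeedbackCode (Fin 3) (Fin 3) ⌈(2 : ℝ) ^ ((n : ℝ) * R)⌉₊ n,
      (∃ c' : FeedbackCode (Fin 3) (Fin 3) ⌈(2 : ℝ) ^ ((n : ℝ) * R)⌉₊ n,
        (ising (Fin 3)).errorProb s₀ c' ≤ Real.exp (- (7 / 8 * ε ^ 2) * n)) →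
      (ising (Fin 3)).errorProb s₀ c ≤ Real.exp (- (7 / 8 * ε ^ 2) * n) := by
    intro n
    by_cases h : ∃ c' : FeedbackCode (Fin 3) (Fin 3) ⌈(2 : ℝ) ^ ((n : ℝ) * R)⌉₊ n,
        (ising (Fin 3)).errorProb s₀ c' ≤ Real.exp (- (7 / 8 * ε ^ 2) * n)
    · exact ⟨h.choose, fun _ => h.choose_spec⟩
    · exact ⟨⟨fun _ _ _ => 0, fun _ => ⟨0, Nat.ceil_pos.2 (by positivity)⟩⟩, fun h' => absurd h' h⟩
  choose c hc using hall
  refine ⟨c, squeeze_zero' (Eventually.of_forall fun n => errorProb_nonneg _ s₀ (c n))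
    (hev.mono fun n hn => hc n hn) ?_⟩
  refine Real.tendsto_exp_atBot.comp ?_
  exact (tendsto_natCast_atTop_atTop).const_mul_atTop_of_neg (by
    have : 0 < ε ^ 2 := by positivity
    linarith)

end UnifilarFSC

/-! ### The capacity theorem -/

theorem theorem2 :
    ∃ C : ℝ,
      (∀ s₀ : Fin 3, (UnifilarFSC.ising (Fin 3)).IsFeedbackCapacity s₀ C) ∧
      IsGreatest (ising3Rate '' Set.Icc (0 : ℝ) 1) C ∧
      |C - 0.961227| ≤ 5e-7 ∧
      ∃ p ∈ Set.Icc (0 : ℝ) 1, ising3Rate p = C ∧ |p - 0.263805| ≤ 5e-7 := by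
  obtain ⟨p, hlo, hhi, hp⟩ := exists_root_of_optimality
  have hp16 : 1 / 16 ≤ p := le_trans (by norm_num) hlo
  have hp0 : 0 < p := lt_of_lt_of_le (by norm_num) hp16
  have hp1 : p < 1 := lt_of_le_of_lt hhi (by norm_num)
  have hmem : p ∈ Set.Icc (0 : ℝ) 1 := ⟨hp0.le, hp1.le⟩
  have heq := ising3Rate_eq hp0 hp1 hp
  have hnum := log_root_bounds hlo hhi
  rw [← heq] at hnum
  refine ⟨ising3Rate p, fun s₀ => ⟨fun R hR => ?_, fun b hb => ?_⟩,
    ⟨⟨p, hmem, rfl⟩, ?_⟩, hnum, p, hmem, rfl, ?_⟩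
  · rw [heq]
    exact UnifilarFSC.ising_converse hp16 hp1 hp s₀ hR
  · have hC : 0 < ising3Rate p := by
      have := (abs_le.1 hnum).1
      norm_num at this
      linarith
    by_contra! hlt
    -- The maximum with 0 keeps `R` nonnegative, as `ising_achievable` requires.
    obtain ⟨R, hR1, hR2⟩ := exists_between (max_lt hlt hC)
    have hRb : b < R := (le_max_left _ _).trans_lt hR1
    exact absurd (hb (UnifilarFSC.ising_achievable hp0 hp1 ((le_max_right _ _).trans hR1.le) hR2 s₀))
      (not_le.2 hRb)
  · rintro _ ⟨q, hq, rfl⟩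
    rw [heq]
    exact ising3Rate_le hp0 hp1 hp hq
  · rw [abs_le]
    constructor <;> norm_num at hlo hhi ⊢ <;> linarith
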